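/- **Theorem 1.3.** For $n\in\mathbb N=\{0,1,2,\dots\}$ let $[n]=\{1,\dots,n\}$ and let $\binom{[n]}{2}$ be the set of two-element subsets of $[n]$. Let $k\ge 0$ be an integer. For $n\ge k$ let $S_{n-k}$ denote the subgroup of the symmetric group $S_n$ consisting of all $\sigma\in S_n$ with $\sigma(i)=i$ for all $i\in[k]$; it acts on $\binom{[n]}{2}$ by $\sigma\cdot\{i,j\}=\{\sigma(i),\sigma(j)\}$. Suppose that $(A^{(n)})_{n\ge k}$ is a sequence of symmetric matrices such that 1. $A^{(n)}\in\mathbb R^{\binom{[n]}{2}\times\binom{[n]}{2}}$ for each $n\ge k$; 2. $A^{(n')}_{e,f}=A^{(n)}_{e,f}$ for all $n,n'\in\mathbb N$ with $k\le n'\le n$ and all $e,f\in\binom{[n']}{2}$; 3. $A^{(n)}_{\sigma\cdot e,\sigma\cdot f}=A^{(n)}_{e,f}$ for all $n\ge k$, all $\sigma\in S_{n-k}$ and all $e,f\in\binom{[n]}{2}$. Write $a_{(e,f)}$ for the $(e,f)$-th entry of $A^{(k+4)}$. Then $A^{(n)}$ is positive semidefinite for every $n\ge k$ if and only if the following three conditions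 all hold. (a) $$a_{(\{k+1,k+2\},\{k+1,k+2\})}-2\,a_{(\{k+1,k+2\},\{k+1,k+3\})}+a_{(\{k+1,k+2\},\{k+3,k+4\})}\ge 0.$$ (b) The symmetric matrix of order $\binom k2+k+1$ $$\begin{pmatrix} C_{11}&C_{12}&C_{13}\\ C_{12}^{\mathsf T}&C_{22}&C_{23}\\ C_{13}^{\mathsf T}&C_{23}^{\mathsf T}&C_{33}\end{pmatrix}$$ is positive semidefinite, where $$\begin{aligned} C_{11}&=\big(a_{(e,f)}\big)_{e,f\in\binom{[k]}{2}}, & C_{12}&=\big(a_{(e,\{j,k+1\})}\big)_{e\in\binom{[k]}{2},\,j\in[k]}, & C_{13}&=\big(a_{(e,\{k+1,k+2\})}\big)_{e\in\binom{[k]}{2}},\\ C_{22}&=\big(a_{(\{i,k+1\},\{j,k+2\})}\big)_{i,j\in[k]}, & C_{23}&=\big(a_{(\{i,k+1\},\{k+2,k+3\})}\big)_{i\in[k]}, & C_{33}&=a_{(\{k+1,k+2\},\{k+3,k+4\})}. \end{aligned}$$ (c) The symmetric matrix of order $k+1$ $$\begin{pmatrix} D_{11}&D_{12}\\ D_{12}^{\mathsf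 T}&D_{22}\end{pmatrix}$$ is positive semidefinite, where $$\begin{aligned} D_{11}&=\big(a_{(\{i,k+1\},\{j,k+1\})}-a_{(\{i,k+1\},\{j,k+2\})}\big)_{i,j\in[k]},\\ D_{12}&=\big(a_{(\{i,k+1\},\{k+1,k+2\})}-a_{(\{i,k+1\},\{k+2,k+3\})}\big)_{i\in[k]},\\ D_{22}&=a_{(\{k+1,k+2\},\{k+1,k+3\})}-a_{(\{k+1,k+2\},\{k+3,k+4\})}. \end{aligned}$$ -/

import Mathlib

namespace EdgeMatrix

/-- The set of two-element subsets of `[n]`. The elements `1, …, n` of `[n]` are represented by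
`0, …, n - 1` in `Fin n`. -/
abbrev Edge (n : ℕ) : Type := Set.powersetCard (Fin n) 2

/-- The inclusion of the two-element subsets of `[m]` into those of `[n]`, for `m ≤ n`. -/
def Edge.incl {m n : ℕ} (h : m ≤ n) (e : Edge m) : Edge n :=
  Set.powersetCard.map 2 (Fin.castLEEmb h) e

/-- The subgroup `S_{n-k}` of `S_n` of all permutations that fix `1, …, k`. -/
def permFixing (k n : ℕ) : Subgroup (Equiv.Perm (Fin n)) :=
  fixingSubgroup (Equiv.Perm (Fin n)) {i : Fin n | (i : ℕ) < k}

/-- The element `j` of `[k]`, seen in `[k+4]`. -/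
abbrev old {k : ℕ} (j : Fin k) : Fin (k + 4) := Fin.castAdd 4 j

/-- `new k 0`, `new k 1`, `new k 2`, `new k 3` are the elements `k+1`, `k+2`, `k+3`, `k+4` of
`[k+4]`. -/
abbrev new (k : ℕ) (t : Fin 4) : Fin (k + 4) := Fin.natAdd k t

theorem old_ne_new {k : ℕ} (j : Fin k) (t : Fin 4) : old j ≠ new k t := by
  intro h
  have h1 := congrArg Fin.val h
  have h2 := j.isLt
  simp at h1
  omega

theorem new_ne_new (k : ℕ) {s t : Fin 4} (h : s ≠ t) : new k s ≠ new k t := by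
  intro h1
  exact h (by simpa using h1)

/-- A subset `e` of `[k]` with two elements, seen as a subset of `[k+4]`. -/
def inner {k : ℕ} (e : Edge k) : Edge (k + 4) := e.incl (Nat.le_add_right k 4)

/-- The edge `{j, k+1+t}` of `[k+4]`, for `j ∈ [k]` and `t ∈ {0, 1, 2, 3}`. -/
def mixed {k : ℕ} (j : Fin k) (t : Fin 4) : Edge (k + 4) :=
  ⟨{old j, new k t}, Finset.card_pair (old_ne_new j t)⟩

/-- The edge `{k+1+s, k+1+t}` of `[k+4]`, for distinct `s, t ∈ {0, 1, 2, 3}`. -/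
def outer (k : ℕ) (s t : Fin 4) (h : s ≠ t := by decide) : Edge (k + 4) :=
  ⟨{new k s, new k t}, Finset.card_pair (new_ne_new k h)⟩

/-- The scalar `a({k+1,k+2},{k+1,k+2}) - 2 a({k+1,k+2},{k+1,k+3}) + a({k+1,k+2},{k+3,k+4})`. -/
def scalarBlock {k : ℕ} (a : Matrix (Edge (k + 4)) (Edge (k + 4)) ℝ) : ℝ :=
  a (outer k 0 1) (outer k 0 1) - 2 * a (outer k 0 1) (outer k 0 2)
    + a (outer k 0 1) (outer k 2 3)

/-- The matrix of order `k.choose 2 + k + 1`, with rows and columns indexed by the two-element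
subsets of `[k]`, then the elements of `[k]`, then one further index. -/
def largeBlock {k : ℕ} (a : Matrix (Edge (k + 4)) (Edge (k + 4)) ℝ) :
    Matrix (Edge k ⊕ Fin k ⊕ Unit) (Edge k ⊕ Fin k ⊕ Unit) ℝ :=
  Matrix.of fun r c => match r, c with
    | .inl e, .inl f => a (inner e) (inner f)
    | .inl e, .inr (.inl j) => a (inner e) (mixed j 0)
    | .inl e, .inr (.inr _) => a (inner e) (outer k 0 1)
    | .inr (.inl j), .inl e => a (inner e) (mixed j 0)
    | .inr (.inl i), .inr (.inl j) => a (mixed i 0) (mixed j 1)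
    | .inr (.inl i), .inr (.inr _) => a (mixed i 0) (outer k 1 2)
    | .inr (.inr _), .inl e => a (inner e) (outer k 0 1)
    | .inr (.inr _), .inr (.inl i) => a (mixed i 0) (outer k 1 2)
    | .inr (.inr _), .inr (.inr _) => a (outer k 0 1) (outer k 2 3)

/-- The matrix of order `k + 1`, with rows and columns indexed by the elements of `[k]` and one
further index. -/
def smallBlock {k : ℕ} (a : Matrix (Edge (k + 4)) (Edge (k + 4)) ℝ) :
    Matrix (Fin k ⊕ Unit) (Fin k ⊕ Unit) ℝ :=
  Matrix.of fun r c => match r, c with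
    | .inl i, .inl j => a (mixed i 0) (mixed j 0) - a (mixed i 0) (mixed j 1)
    | .inl i, .inr _ => a (mixed i 0) (outer k 0 1) - a (mixed i 0) (outer k 1 2)
    | .inr _, .inl i => a (mixed i 0) (outer k 0 1) - a (mixed i 0) (outer k 1 2)
    | .inr _, .inr _ => a (outer k 0 1) (outer k 0 2) - a (outer k 0 1) (outer k 2 3)

end EdgeMatrix

/-! ### Criteria for positive semidefiniteness -/

namespace Matrix

/-! Call the elements outside `[k]` fresh. By invariance, an entry depends only on the parts of the
two edges inside `[k]` and on which fresh elements coincide. Expanding in these coincidences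
(`apply_edge_edge`) writes the matrix as a pullback of the large block, plus, for each fresh `s`,
the small block weighted by incidence with `s`, plus the scalar times the identity on outer edges.
If the three blocks are positive semidefinite, so is every summand.

Conversely, each block is isolated by test vectors. For the large block, average over many copies
with disjoint fresh elements: the diagonal terms grow like `N`, the others like `N ^ 2`
(`posSemidef_of_forall_block`). For the small block, average in the same way over edges through one
of two fixed fresh elements, then take the difference of the two halves (`sub_of_bool_block`). For
the scalar, put alternating signs on a 4-cycle. -/

theorem posSemidef_of_submatrix_surjective {I J : Type*} {M : Matrix I I ℝ} {g : J → I}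
    (hg : Function.Surjective g) (h : (M.submatrix g g).PosSemidef) : M.PosSemidef := by
  obtain ⟨s, hs⟩ := hg.hasRightInverse
  have h1 := h.submatrix s
  rw [submatrix_submatrix] at h1
  have h2 : g ∘ s = id := funext hs
  rwa [h2, submatrix_id_id] at h1

/-- If matrices with `N` equal diagonal blocks `E` and all off-diagonal blocks equal to `C` are
positive semidefinite for all `N`, then so is `C`. -/
theorem posSemidef_of_forall_block {I : Type*} [Fintype I] {C E : Matrix I I ℝ}
    (hC : C.IsHermitian)
    (h : ∀ N : ℕ, (Matrix.of fun x y : Fin N × I =>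
      if x.1 = y.1 then E x.2 y.2 else C x.2 y.2).PosSemidef) : C.PosSemidef := by
  refine PosSemidef.of_dotProduct_mulVec_nonneg hC fun z => ?_
  set c := star z ⬝ᵥ C *ᵥ z with hc
  set d := star z ⬝ᵥ E *ᵥ z with hd
  have key (N : ℕ) : 0 ≤ (N : ℝ) * d + N * (N - 1) * c := by
    have h1 := (h N).dotProduct_mulVec_nonneg fun x => z x.2
    have h2 : star (fun x : Fin N × I => z x.2) ⬝ᵥ (Matrix.of fun x y : Fin N × I =>
        if x.1 = y.1 then E x.2 y.2 else C x.2 y.2) *ᵥ (fun x => z x.2) =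
        ∑ s : Fin N, ∑ t : Fin N, if s = t then d else c := by
      simp only [dotProduct, mulVec, Fintype.sum_prod_type, of_apply, hc, hd, Finset.mul_sum]
      refine Finset.sum_congr rfl fun s _ => ?_
      rw [Finset.sum_comm]
      refine Finset.sum_congr rfl fun t _ => ?_
      split_ifs <;> rfl
    rw [h2] at h1
    have h3 (s t : Fin N) : (if s = t then d else c) = c + if s = t then d - c else 0 := by
      split_ifs <;> ring
    simp only [h3, Finset.sum_add_distrib, Finset.sum_ite_eq, Finset.mem_univ, if_true,
      Finset.sum_const, Finset.card_univ, Fintype.card_fin, nsmul_eq_mul] at h1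
    linarith
  by_contra hneg
  push Not at hneg
  -- The bound `key (N + 1)` is `(N + 1) * (d + N * c) ≥ 0`, which fails once `d < N * (-c)`.
  obtain ⟨N, hN⟩ := exists_nat_gt (d / (-c))
  rw [div_lt_iff₀ (by linarith)] at hN
  have h1 := key (N + 1)
  push_cast at h1
  nlinarith [h1, hN, (Nat.cast_nonneg N : (0 : ℝ) ≤ N)]

/-- If the block matrix with diagonal blocks `P`, `P` and off-diagonal blocks `Q`, `Q` is positive
semidefinite, then so is `P - Q`. -/
theorem PosSemidef.sub_of_bool_block {I : Type*} [Fintype I] {P Q : Matrix I I ℝ}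
    (h : (Matrix.of fun x y : Bool × I =>
      if x.1 = y.1 then P x.2 y.2 else Q x.2 y.2).PosSemidef) : (P - Q).PosSemidef := by
  refine PosSemidef.of_dotProduct_mulVec_nonneg ?_ fun z => ?_
  · ext i j
    have h1 := h.1.apply (true, i) (true, j)
    have h2 := h.1.apply (true, i) (false, j)
    simp at h1 h2
    simp [h1, h2]
  -- The test vector `(z, -z)` gives twice the quadratic form of `P - Q`.
  · have h1 := h.dotProduct_mulVec_nonneg fun x => (if x.1 then 1 else -1) * z x.2
    simp only [dotProduct, mulVec, Fintype.sum_prod_type, of_apply, Fintype.sum_bool] at h1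
    simp only [Pi.star_apply, star_trivial] at h1
    simp only [if_true, Bool.false_eq_true, Bool.true_eq_false, if_false, one_mul] at h1
    simp only [dotProduct, mulVec, sub_apply, Pi.star_apply, star_trivial, sub_mul,
      Finset.sum_sub_distrib, mul_sub, neg_mul, mul_neg, one_mul, mul_add, Finset.sum_add_distrib,
      Finset.sum_neg_distrib] at h1 ⊢
    linarith

/-- Pulling back a positive semidefinite matrix along `g` and rescaling rows and columns by `w`. -/
theorem PosSemidef.weighted_submatrix {I J : Type*} [Fintype J] {M : Matrix I I ℝ}
    (hM : M.PosSemidef) (w : J → ℝ) (g : J → I) :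
    (Matrix.of fun x y => w x * w y * M (g x) (g y)).PosSemidef := by
  classical
  have h := (hM.submatrix g).conjTranspose_mul_mul_same (diagonal w)
  convert h using 1
  ext x y
  simp [diagonal_mul, mul_diagonal]
  ring

end Matrix

/-! ### Edges of `[k+m]` and embeddings fixing `[k]` -/

namespace EdgeMatrix

theorem injective_pair {α : Type*} {s t : α} (h : s ≠ t) : Function.Injective ![s, t] := by
  intro a b
  fin_cases a <;> fin_cases b <;> simp [h, h.symm]

theorem injective_triple {α : Type*} {s t u : α} (hst : s ≠ t) (hsu : s ≠ u) (htu : t ≠ u) :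
    Function.Injective ![s, t, u] := by
  intro a b
  fin_cases a <;> fin_cases b <;> simp [hst, hsu, htu, hst.symm, hsu.symm, htu.symm]

theorem injective_quadruple {α : Type*} {s t u v : α} (hst : s ≠ t) (hsu : s ≠ u) (hsv : s ≠ v)
    (htu : t ≠ u) (htv : t ≠ v) (huv : u ≠ v) : Function.Injective ![s, t, u, v] := by
  intro a b
  fin_cases a <;> fin_cases b <;>
    simp [hst, hsu, htu, hst.symm, hsu.symm, htu.symm, hsv, htv, huv, hsv.symm, htv.symm, huv.symm]

/-- The embedding of `[k+p]` into `[k+m]` that fixes `[k]` and moves the other elements by `v`. -/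
def extendFresh (k : ℕ) {p m : ℕ} (v : Fin p ↪ Fin m) : Fin (k + p) ↪ Fin (k + m) where
  toFun := Fin.addCases (Fin.castAdd m) (fun t => Fin.natAdd k (v t))
  inj' := by
    intro a b
    induction a using Fin.addCases with
    | left i =>
      induction b using Fin.addCases with
      | left j => simp
      | right t =>
        intro h
        have h1 := congrArg Fin.val h
        simp at h1
        omega
    | right s =>
      induction b using Fin.addCases with
      | left j =>
        intro h
        have h1 := congrArg Fin.val h
        simp at h1
        omega
      | right t => simp

@[simp]
theorem extendFresh_castAdd (k : ℕ) {p m : ℕ} (v : Fin p ↪ Fin m) (i : Fin k) :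
    extendFresh k v (Fin.castAdd p i) = Fin.castAdd m i := by
  simp [extendFresh, Fin.addCases]

@[simp]
theorem extendFresh_natAdd (k : ℕ) {p m : ℕ} (v : Fin p ↪ Fin m) (t : Fin p) :
    extendFresh k v (Fin.natAdd k t) = Fin.natAdd k (v t) := by
  simp [extendFresh, Fin.addCases]

theorem castAdd_ne_natAdd {k m : ℕ} (i : Fin k) (s : Fin m) :
    Fin.castAdd m i ≠ Fin.natAdd k s := by
  intro h
  have h1 := congrArg Fin.val h
  have h2 := i.isLt
  simp at h1
  omega

/-- A two-element subset of `[k]`, seen in `[k+m]`. -/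
def innerAt {k : ℕ} (m : ℕ) (e : Edge k) : Edge (k + m) := e.incl (Nat.le_add_right k m)

/-- The edge `{i, k+1+s}` of `[k+m]`. -/
def mixedAt {k m : ℕ} (i : Fin k) (s : Fin m) : Edge (k + m) :=
  ⟨{Fin.castAdd m i, Fin.natAdd k s}, Finset.card_pair (castAdd_ne_natAdd i s)⟩

/-- The edge `{k+1+s, k+1+t}` of `[k+m]`. -/
def outerAt (k : ℕ) {m : ℕ} (s t : Fin m) (h : s ≠ t) : Edge (k + m) :=
  ⟨{Fin.natAdd k s, Fin.natAdd k t}, Finset.card_pair (by simpa using h)⟩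

theorem outerAt_comm (k : ℕ) {m : ℕ} {s t : Fin m} (h : s ≠ t) :
    outerAt k s t h = outerAt k t s h.symm :=
  Subtype.ext (Finset.pair_comm _ _)

theorem edge_cases {k m : ℕ} {motive : Edge (k + m) → Prop}
    (hinner : ∀ e, motive (innerAt m e)) (hmixed : ∀ i s, motive (mixedAt i s))
    (houter : ∀ s t h, motive (outerAt k s t h)) (e : Edge (k + m)) : motive e := by
  obtain ⟨e, he⟩ := e
  obtain ⟨x, y, hxy, rfl⟩ := Finset.card_eq_two.mp he
  induction x using Fin.addCases with
  | left i =>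
    induction y using Fin.addCases with
    | left j =>
      have hij : i ≠ j := fun h => hxy (by rw [h])
      have h := hinner ⟨{i, j}, Finset.card_pair hij⟩
      have heq : innerAt m ⟨{i, j}, Finset.card_pair hij⟩ =
          (⟨{Fin.castAdd m i, Fin.castAdd m j}, he⟩ : Edge (k + m)) := by
        apply Subtype.ext
        simp [innerAt, Edge.incl, Finset.map_insert, Fin.castAdd]
      rwa [heq] at h
    | right t => exact hmixed i t
  | right s =>
    induction y using Fin.addCases with
    | left j =>
      have h := hmixed j s
      have heq : mixedAt j s =
          (⟨{Fin.natAdd k s, Fin.castAdd m j}, he⟩ : Edge (k + m)) :=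
        Subtype.ext (Finset.pair_comm _ _)
      rwa [heq] at h
    | right t => exact houter s t (fun h => hxy (by rw [h]))

theorem map_extendFresh_innerAt {k p m : ℕ} (v : Fin p ↪ Fin m) (e : Edge k) :
    Set.powersetCard.map 2 (extendFresh k v) (innerAt p e) = innerAt m e := by
  apply Subtype.ext
  simp only [innerAt, Edge.incl, Set.powersetCard.val_map, Finset.map_map]
  congr 1
  ext i : 1
  exact extendFresh_castAdd k v i

theorem map_extendFresh_mixedAt {k p m : ℕ} (v : Fin p ↪ Fin m) (i : Fin k) (s : Fin p) :
    Set.powersetCard.map 2 (extendFresh k v) (mixedAt i s) = mixedAt i (v s) := by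
  apply Subtype.ext
  simp [mixedAt, Finset.map_insert]

theorem map_extendFresh_outerAt {k p m : ℕ} (v : Fin p ↪ Fin m) {s t : Fin p} (h : s ≠ t) :
    Set.powersetCard.map 2 (extendFresh k v) (outerAt k s t h) =
      outerAt k (v s) (v t) (v.injective.ne h) := by
  apply Subtype.ext
  simp [outerAt, Finset.map_insert]

/-- The matrices of the family are symmetric and agree along every injection that
fixes `[k]`. -/
structure FreshInvariant (k : ℕ) (A : (n : ℕ) → Matrix (Edge n) (Edge n) ℝ) : Prop where
  symm : ∀ m (e f : Edge (k + m)), A (k + m) e f = A (k + m) f e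
  map : ∀ {p m : ℕ} (v : Fin p ↪ Fin m) (e f : Edge (k + p)),
    A (k + m) (Set.powersetCard.map 2 (extendFresh k v) e)
      (Set.powersetCard.map 2 (extendFresh k v) f) = A (k + p) e f

/-- An injection `[k+p] → [k+m]` fixing `[k]` is the inclusion followed by a permutation of `[k+m]`
fixing `[k]`, since a bijection between subsets of a finite set extends. Inclusion and permutation
each preserve entries. -/
theorem freshInvariant_of_restrict_of_perm {k : ℕ}
    {A : (n : ℕ) → Matrix (Edge n) (Edge n) ℝ}
    (hsymm : ∀ n, k ≤ n → (A n).IsSymm)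
    (hrestrict : ∀ (m n : ℕ) (hmn : m ≤ n), k ≤ m → ∀ e f : Edge m,
      A m e f = A n (e.incl hmn) (f.incl hmn))
    (hinv : ∀ n, k ≤ n → ∀ σ ∈ permFixing k n, ∀ e f : Edge n,
      A n (σ • e) (σ • f) = A n e f) : FreshInvariant k A where
  symm m e f := ((hsymm (k + m) (Nat.le_add_right k m)).apply e f).symm
  map {p m} v e f := by
    have hpm : k + p ≤ k + m := by
      simpa using Fintype.card_le_of_embedding (extendFresh k v)
    let ι := Fin.castLEEmb hpm
    let τ := (Equiv.ofInjective ι ι.injective).symm.trans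
      (Equiv.ofInjective (extendFresh k v) (extendFresh k v).injective)
    let σ : Equiv.Perm (Fin (k + m)) := τ.extendSubtype
    have hσ (x : Fin (k + p)) : σ (ι x) = extendFresh k v x := by
      have h := τ.extendSubtype_apply_of_mem (ι x) ⟨x, rfl⟩
      refine h.trans ?_
      have h' : (⟨ι x, ⟨x, rfl⟩⟩ : Set.range ι) = Equiv.ofInjective ι ι.injective x := rfl
      simp only [τ, Equiv.trans_apply]
      erw [h', Equiv.symm_apply_apply]
      rfl
    have hmem : σ ∈ permFixing k (k + m) := by
      rw [permFixing, mem_fixingSubgroup_iff]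
      intro y hy
      have hy' : (y : ℕ) < k := hy
      have h := hσ (Fin.castAdd p ⟨y, hy'⟩)
      rw [extendFresh_castAdd] at h
      exact h
    have hmap (g : Edge (k + p)) :
        Set.powersetCard.map 2 (extendFresh k v) g = σ • g.incl hpm := by
      apply Subtype.ext
      rw [Set.powersetCard.coe_smul]
      ext x
      simp only [Set.powersetCard.val_map, Edge.incl, Finset.mem_map, Finset.mem_smul_finset]
      constructor
      · rintro ⟨y, hy, rfl⟩
        exact ⟨_, ⟨y, hy, rfl⟩, hσ y⟩
      · rintro ⟨_, ⟨y, hy, rfl⟩, rfl⟩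
        exact ⟨y, hy, (hσ y).symm⟩
    rw [hmap, hmap, hinv _ (Nat.le_add_right k m) σ hmem,
      ← hrestrict _ _ hpm (Nat.le_add_right k p)]

/-! ### Entries by coincidence pattern -/

namespace FreshInvariant

variable {k : ℕ} {A : (n : ℕ) → Matrix (Edge n) (Edge n) ℝ}

/-- Both sides come from the same pair of edges in `[k+p]`, where `p` counts the fresh elements that
occur (here none). The lemmas below follow this pattern with larger `p`. -/
theorem inner_inner (hA : FreshInvariant k A) {m : ℕ} (e f : Edge k) :
    A (k + m) (innerAt m e) (innerAt m f) = A (k + 4) (inner e) (inner f) := by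
  have h1 := hA.map (p := 0) (m := m) ⟨![], fun x => x.elim0⟩ (innerAt 0 e) (innerAt 0 f)
  have h2 := hA.map (p := 0) (m := 4) ⟨![], fun x => x.elim0⟩ (innerAt 0 e) (innerAt 0 f)
  simp only [map_extendFresh_innerAt] at h1 h2
  exact h1.trans h2.symm

theorem inner_mixed (hA : FreshInvariant k A) {m : ℕ} (e : Edge k) (j : Fin k) (s : Fin m) :
    A (k + m) (innerAt m e) (mixedAt j s) = A (k + 4) (inner e) (mixed j 0) := by
  have h1 := hA.map (p := 1) ⟨![s], Function.injective_of_subsingleton _⟩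
    (innerAt 1 e) (mixedAt j 0)
  have h2 := hA.map (p := 1) (m := 4) ⟨![0], Function.injective_of_subsingleton _⟩
    (innerAt 1 e) (mixedAt j 0)
  simp only [map_extendFresh_innerAt, map_extendFresh_mixedAt] at h1 h2
  exact h1.trans h2.symm

theorem mixed_mixed_self (hA : FreshInvariant k A) {m : ℕ} (i j : Fin k) (s : Fin m) :
    A (k + m) (mixedAt i s) (mixedAt j s) = A (k + 4) (mixed i 0) (mixed j 0) := by
  have h1 := hA.map (p := 1) ⟨![s], Function.injective_of_subsingleton _⟩
    (mixedAt i 0) (mixedAt j 0)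
  have h2 := hA.map (p := 1) (m := 4) ⟨![0], Function.injective_of_subsingleton _⟩
    (mixedAt i 0) (mixedAt j 0)
  simp only [map_extendFresh_mixedAt] at h1 h2
  exact h1.trans h2.symm

theorem inner_outer (hA : FreshInvariant k A) {m : ℕ} (e : Edge k) {s t : Fin m} (h : s ≠ t) :
    A (k + m) (innerAt m e) (outerAt k s t h) = A (k + 4) (inner e) (outer k 0 1) := by
  have h1 := hA.map (p := 2) ⟨![s, t], injective_pair h⟩
    (innerAt 2 e) (outerAt k 0 1 (by decide))
  have h2 := hA.map (p := 2) (m := 4) ⟨![0, 1], injective_pair (by decide)⟩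
    (innerAt 2 e) (outerAt k 0 1 (by decide))
  simp only [map_extendFresh_innerAt, map_extendFresh_outerAt] at h1 h2
  exact h1.trans h2.symm

theorem mixed_mixed_of_ne (hA : FreshInvariant k A) {m : ℕ} (i j : Fin k) {s t : Fin m}
    (h : s ≠ t) :
    A (k + m) (mixedAt i s) (mixedAt j t) = A (k + 4) (mixed i 0) (mixed j 1) := by
  have h1 := hA.map (p := 2) ⟨![s, t], injective_pair h⟩ (mixedAt i 0) (mixedAt j 1)
  have h2 := hA.map (p := 2) (m := 4) ⟨![0, 1], injective_pair (by decide)⟩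
    (mixedAt i 0) (mixedAt j 1)
  simp only [map_extendFresh_mixedAt] at h1 h2
  exact h1.trans h2.symm

theorem mixed_outer_self (hA : FreshInvariant k A) {m : ℕ} (i : Fin k) {s t : Fin m}
    (h : s ≠ t) :
    A (k + m) (mixedAt i s) (outerAt k s t h) = A (k + 4) (mixed i 0) (outer k 0 1) := by
  have h1 := hA.map (p := 2) ⟨![s, t], injective_pair h⟩
    (mixedAt i 0) (outerAt k 0 1 (by decide))
  have h2 := hA.map (p := 2) (m := 4) ⟨![0, 1], injective_pair (by decide)⟩
    (mixedAt i 0) (outerAt k 0 1 (by decide))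
  simp only [map_extendFresh_mixedAt, map_extendFresh_outerAt] at h1 h2
  exact h1.trans h2.symm

theorem mixed_outer_of_ne (hA : FreshInvariant k A) {m : ℕ} (i : Fin k) {s t u : Fin m}
    (hst : s ≠ t) (hsu : s ≠ u) (htu : t ≠ u) :
    A (k + m) (mixedAt i s) (outerAt k t u htu) = A (k + 4) (mixed i 0) (outer k 1 2) := by
  have h1 := hA.map (p := 3) ⟨![s, t, u], injective_triple hst hsu htu⟩
    (mixedAt i 0) (outerAt k 1 2 (by decide))
  have h2 := hA.map (p := 3) (m := 4)
    ⟨![0, 1, 2], injective_triple (by decide) (by decide) (by decide)⟩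
    (mixedAt i 0) (outerAt k 1 2 (by decide))
  simp only [map_extendFresh_mixedAt, map_extendFresh_outerAt] at h1 h2
  exact h1.trans h2.symm

theorem outer_outer_self (hA : FreshInvariant k A) {m : ℕ} {s t : Fin m} (h : s ≠ t) :
    A (k + m) (outerAt k s t h) (outerAt k s t h) = A (k + 4) (outer k 0 1) (outer k 0 1) := by
  have h1 := hA.map (p := 2) ⟨![s, t], injective_pair h⟩
    (outerAt k 0 1 (by decide)) (outerAt k 0 1 (by decide))
  have h2 := hA.map (p := 2) (m := 4) ⟨![0, 1], injective_pair (by decide)⟩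
    (outerAt k 0 1 (by decide)) (outerAt k 0 1 (by decide))
  simp only [map_extendFresh_outerAt] at h1 h2
  exact h1.trans h2.symm

theorem outer_outer_adjacent (hA : FreshInvariant k A) {m : ℕ} {s t u : Fin m}
    (hst : s ≠ t) (hsu : s ≠ u) (htu : t ≠ u) :
    A (k + m) (outerAt k s t hst) (outerAt k s u hsu) =
      A (k + 4) (outer k 0 1) (outer k 0 2) := by
  have h1 := hA.map (p := 3) ⟨![s, t, u], injective_triple hst hsu htu⟩
    (outerAt k 0 1 (by decide)) (outerAt k 0 2 (by decide))
  have h2 := hA.map (p := 3) (m := 4)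
    ⟨![0, 1, 2], injective_triple (by decide) (by decide) (by decide)⟩
    (outerAt k 0 1 (by decide)) (outerAt k 0 2 (by decide))
  simp only [map_extendFresh_outerAt] at h1 h2
  exact h1.trans h2.symm

theorem outer_outer_disjoint (hA : FreshInvariant k A) {m : ℕ} {s t u v : Fin m}
    (hst : s ≠ t) (huv : u ≠ v) (hsu : s ≠ u) (hsv : s ≠ v) (htu : t ≠ u) (htv : t ≠ v) :
    A (k + m) (outerAt k s t hst) (outerAt k u v huv) =
      A (k + 4) (outer k 0 1) (outer k 2 3) := by
  have h1 := hA.map (p := 4) ⟨![s, t, u, v], injective_quadruple hst hsu hsv htu htv huv⟩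
    (outerAt k 0 1 (by decide)) (outerAt k 2 3 (by decide))
  simp only [map_extendFresh_outerAt] at h1
  exact h1

end FreshInvariant
end EdgeMatrix

/-! ### Decomposition into blocks and sufficiency -/

namespace EdgeMatrix

/-- Labels for the two-element subsets of `[k+m]`, sorted by the size of their intersection
with `[k]`. -/
abbrev Node (k m : ℕ) : Type :=
  Edge k ⊕ (Fin k × Fin m) ⊕ {p : Fin m × Fin m // p.1 ≠ p.2}

namespace Node

variable {k m : ℕ}

/-- The edge with a given label. -/
def edge : Node k m → Edge (k + m)
  | .inl e => innerAt m e
  | .inr (.inl p) => mixedAt p.1 p.2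
  | .inr (.inr p) => outerAt k p.1.1 p.1.2 p.2

theorem edge_surjective : Function.Surjective (edge : Node k m → Edge (k + m)) := fun e =>
  edge_cases (motive := fun e => ∃ x : Node k m, x.edge = e) (fun e => ⟨.inl e, rfl⟩)
    (fun i s => ⟨.inr (.inl (i, s)), rfl⟩) (fun s t h => ⟨.inr (.inr ⟨(s, t), h⟩), rfl⟩) e

/-- The index of a label in the large block. -/
def largeIndex : Node k m → Edge k ⊕ Fin k ⊕ Unit
  | .inl e => .inl e
  | .inr (.inl p) => .inr (.inl p.1)
  | .inr (.inr _) => .inr (.inr ())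

/-- The index of a label in the small block. -/
def smallIndex : Node k m → Fin k ⊕ Unit
  -- An arbitrary value: inner edges have incidence zero.
  | .inl _ => .inr ()
  | .inr (.inl p) => .inl p.1
  | .inr (.inr _) => .inr ()

/-- The indicator of the element `k+1+s` on the edge. -/
def incidence (s : Fin m) : Node k m → ℝ
  | .inl _ => 0
  | .inr (.inl p) => if p.2 = s then 1 else 0
  | .inr (.inr p) => (if p.1.1 = s then 1 else 0) + if p.1.2 = s then 1 else 0

/-- The indicator of the edges that are disjoint from `[k]`. -/
def isOuter : Node k m → ℝ
  | .inl _ => 0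
  | .inr (.inl _) => 0
  | .inr (.inr _) => 1

/-- The edge as an unordered pair, if it is disjoint from `[k]`. -/
def outerPair : Node k m → Option (Sym2 (Fin m))
  -- Equal values `none` produce ones in the identity matrix; the factor `isOuter` removes them.
  | .inl _ => none
  | .inr (.inl _) => none
  | .inr (.inr p) => some s(p.1.1, p.1.2)

end Node

namespace FreshInvariant

variable {k : ℕ} {A : (n : ℕ) → Matrix (Edge n) (Edge n) ℝ}

/-- With `a`, `b`, `c` the entries for equal, adjacent and disjoint pairs, this is interpolation in
the number of shared elements: `c`, then `c + (b - c) = b`, then `c + 2 * (b - c) + (a - 2 * b + c)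
= a`. -/
theorem outer_outer (hA : FreshInvariant k A) {m : ℕ} {s t u v : Fin m}
    (hst : s ≠ t) (huv : u ≠ v) :
    A (k + m) (outerAt k s t hst) (outerAt k u v huv) =
      A (k + 4) (outer k 0 1) (outer k 2 3) +
      ((if s = u then 1 else 0) + (if s = v then 1 else 0) +
        ((if t = u then 1 else 0) + if t = v then 1 else 0)) *
        (A (k + 4) (outer k 0 1) (outer k 0 2) - A (k + 4) (outer k 0 1) (outer k 2 3)) +
      scalarBlock (A (k + 4)) * if s(s, t) = s(u, v) then 1 else 0 := by
  have hts := hst.symm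
  unfold scalarBlock
  simp only [Sym2.eq_iff]
  by_cases hsu : s = u
  · subst hsu
    by_cases htv : t = v
    · subst htv
      rw [hA.outer_outer_self]
      simp [hst, hts]
      ring
    · rw [hA.outer_outer_adjacent hst huv htv]
      simp [hts, huv, htv]
  · by_cases hsv : s = v
    · subst hsv
      rw [outerAt_comm k huv]
      by_cases htu : t = u
      · subst htu
        rw [hA.outer_outer_self]
        simp [hst, hts]
        ring
      · rw [hA.outer_outer_adjacent hst huv.symm htu]
        simp [hts, hsu, htu]
    · rw [outerAt_comm k hst]
      by_cases htu : t = u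
      · subst htu
        rw [hA.outer_outer_adjacent hst.symm huv hsv]
        simp [hsu, hsv, huv]
      · by_cases htv : t = v
        · subst htv
          rw [outerAt_comm k huv, hA.outer_outer_adjacent hst.symm huv.symm hsu]
          simp [hsu, hsv, htu]
        · rw [hA.outer_outer_disjoint hst.symm huv htu htv hsu hsv]
          simp [hsu, hsv, htu, htv]

theorem mixed_outer (hA : FreshInvariant k A) {m : ℕ} (i : Fin k) {s t u : Fin m} (htu : t ≠ u) :
    A (k + m) (mixedAt i s) (outerAt k t u htu) =
      A (k + 4) (mixed i 0) (outer k 1 2) +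
      ((if s = t then 1 else 0) + if s = u then 1 else 0) *
        (A (k + 4) (mixed i 0) (outer k 0 1) - A (k + 4) (mixed i 0) (outer k 1 2)) := by
  by_cases hst : s = t
  · subst hst
    rw [hA.mixed_outer_self]
    simp [htu]
  · by_cases hsu : s = u
    · subst hsu
      rw [outerAt_comm, hA.mixed_outer_self]
      simp [hst]
    · rw [hA.mixed_outer_of_ne i hst hsu]
      simp [hst, hsu]

theorem mixed_mixed (hA : FreshInvariant k A) {m : ℕ} (i j : Fin k) (s t : Fin m) :
    A (k + m) (mixedAt i s) (mixedAt j t) =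
      A (k + 4) (mixed i 0) (mixed j 1) +
      (if s = t then 1 else 0) *
        (A (k + 4) (mixed i 0) (mixed j 0) - A (k + 4) (mixed i 0) (mixed j 1)) := by
  split_ifs with h
  · subst h
    rw [hA.mixed_mixed_self]
    ring
  · rw [hA.mixed_mixed_of_ne i j h]
    ring

/-- Every matrix of the family is a combination of the three blocks. -/
theorem apply_edge_edge (hA : FreshInvariant k A) {m : ℕ} (x y : Node k m) :
    A (k + m) x.edge y.edge = largeBlock (A (k + 4)) x.largeIndex y.largeIndex +
      ∑ s, x.incidence s * y.incidence s *
        smallBlock (A (k + 4)) x.smallIndex y.smallIndex +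
      scalarBlock (A (k + 4)) *
        (x.isOuter * y.isOuter *
          (1 : Matrix (Option (Sym2 (Fin m))) _ ℝ) x.outerPair y.outerPair) := by
  rw [← Finset.sum_mul]
  obtain e | ⟨i, s⟩ | ⟨⟨s, t⟩, hst⟩ := x <;> obtain f | ⟨j, u⟩ | ⟨⟨u, v⟩, huv⟩ := y <;>
    simp only [Node.edge, Node.largeIndex, Node.smallIndex, Node.incidence, Node.isOuter,
      Node.outerPair, largeBlock, smallBlock, Matrix.of_apply, Matrix.one_apply, zero_mul, mul_zero,
      Finset.sum_const_zero, add_zero, one_mul, mul_one, ite_mul, add_mul, Finset.sum_add_distrib,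
      Finset.sum_ite_eq, Finset.mem_univ, if_true, Option.some.injEq]
  · exact hA.inner_inner e f
  · exact hA.inner_mixed e j u
  · exact hA.inner_outer e huv
  · rw [hA.symm]
    exact hA.inner_mixed f i s
  · rw [hA.mixed_mixed i j s u]
    simp [eq_comm]
  · rw [hA.mixed_outer i huv]
    simp [eq_comm]
    split_ifs <;> ring
  · rw [hA.symm]
    exact hA.inner_outer f hst
  · rw [hA.symm, hA.mixed_outer j hst]
    simp [eq_comm]
    split_ifs <;> ring
  · rw [hA.outer_outer hst huv]
    simp only [eq_comm (a := u), eq_comm (a := v), ite_mul, add_mul, one_mul, zero_mul]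

theorem posSemidef (hA : FreshInvariant k A) (hscalar : 0 ≤ scalarBlock (A (k + 4)))
    (hlarge : (largeBlock (A (k + 4))).PosSemidef) (hsmall : (smallBlock (A (k + 4))).PosSemidef)
    (m : ℕ) : (A (k + m)).PosSemidef := by
  -- Labels of outer edges are ordered pairs, so `Node.edge` is surjective but not injective.
  refine Matrix.posSemidef_of_submatrix_surjective Node.edge_surjective ?_
  have h := ((hlarge.submatrix (Node.largeIndex (m := m))).add
    (Matrix.posSemidef_sum Finset.univ fun s _ =>
      hsmall.weighted_submatrix (Node.incidence (m := m) s) Node.smallIndex)).add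
    ((Matrix.PosSemidef.one.weighted_submatrix (Node.isOuter (k := k) (m := m))
      Node.outerPair).smul hscalar)
  convert h using 1
  ext x y
  simp only [Matrix.submatrix_apply, Matrix.add_apply, Matrix.sum_apply, Matrix.smul_apply,
    Matrix.of_apply, smul_eq_mul]
  exact hA.apply_edge_edge x y

/-! ### Necessity of the three conditions -/

/-- The symmetry of the mixed-mixed part uses the exchange of two fresh elements. -/
theorem largeBlock_isHermitian (hA : FreshInvariant k A) :
    (largeBlock (A (k + 4))).IsHermitian := by
  ext r c
  obtain e | i | _ := r <;> obtain f | j | _ := c <;>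
    simp only [Matrix.conjTranspose_apply, largeBlock, Matrix.of_apply, star_trivial]
  · exact hA.symm 4 _ _
  · rw [hA.symm]
    exact hA.mixed_mixed_of_ne (m := 4) i j (s := 1) (t := 0) (by decide)

/-- The diagonal counterpart of the large block, for edges with the same fresh elements. -/
def largeDiagonal (a : Matrix (Edge (k + 4)) (Edge (k + 4)) ℝ) :
    Matrix (Edge k ⊕ Fin k ⊕ Unit) (Edge k ⊕ Fin k ⊕ Unit) ℝ :=
  Matrix.of fun r c => match r, c with
    | .inr (.inl i), .inr (.inl j) => a (mixed i 0) (mixed j 0)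
    | .inr (.inr _), .inr (.inr _) => a (outer k 0 1) (outer k 0 1)
    | r, c => largeBlock a r c

theorem largeBlock_posSemidef (hA : FreshInvariant k A) (h : ∀ m, (A (k + m)).PosSemidef) :
    (largeBlock (A (k + 4))).PosSemidef := by
  refine Matrix.posSemidef_of_forall_block (E := largeDiagonal (A (k + 4)))
    hA.largeBlock_isHermitian fun N => ?_
  -- Each copy owns three fresh elements: one for its mixed edges, two for its outer edge. Distinct
  -- copies share none, so their common entries are those of the large block.
  let v (s : Fin N) (j : Fin 3) : Fin (N * 3) := finProdFinEquiv (s, j)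
  have hv (s t i j) : v s i = v t j ↔ s = t ∧ i = j := by simp [v]
  let g : Fin N × (Edge k ⊕ Fin k ⊕ Unit) → Edge (k + N * 3) := fun x => match x with
    | (_, .inl e) => innerAt _ e
    | (s, .inr (.inl i)) => mixedAt i (v s 0)
    | (s, .inr (.inr _)) => outerAt k (v s 1) (v s 2) (by simp [hv])
  convert (h (N * 3)).submatrix g using 1
  ext ⟨s, r⟩ ⟨t, c⟩
  obtain e | i | _ := r <;> obtain f | j | _ := c <;>
    simp only [Matrix.submatrix_apply, largeBlock, largeDiagonal, Matrix.of_apply, g, ite_self]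
  · exact (hA.inner_inner e f).symm
  · exact (hA.inner_mixed e j _).symm
  · exact (hA.inner_outer e _).symm
  · rw [hA.symm (N * 3)]
    exact (hA.inner_mixed f i _).symm
  · rw [hA.mixed_mixed]
    simp only [hv, and_true]
    split_ifs <;> ring
  · rw [hA.mixed_outer]
    simp [hv]
  · rw [hA.symm (N * 3)]
    exact (hA.inner_outer f _).symm
  · rw [hA.symm (N * 3), hA.mixed_outer]
    simp [hv]
  · rw [hA.outer_outer]
    simp only [hv, Sym2.eq_iff, scalarBlock]
    split_ifs <;> simp_all
    ring

/-- The entries that pairs of edges through a common fresh element contribute to the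
small block. -/
def smallSame (a : Matrix (Edge (k + 4)) (Edge (k + 4)) ℝ) :
    Matrix (Fin k ⊕ Unit) (Fin k ⊕ Unit) ℝ :=
  Matrix.of fun r c => match r, c with
    | .inl i, .inl j => a (mixed i 0) (mixed j 0)
    | .inl i, .inr _ => a (mixed i 0) (outer k 0 1)
    | .inr _, .inl i => a (mixed i 0) (outer k 0 1)
    | .inr _, .inr _ => a (outer k 0 1) (outer k 0 2)

/-- The entries that pairs of edges without a common fresh element contribute to the
small block. -/
def smallDistinct (a : Matrix (Edge (k + 4)) (Edge (k + 4)) ℝ) :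
    Matrix (Fin k ⊕ Unit) (Fin k ⊕ Unit) ℝ :=
  Matrix.of fun r c => match r, c with
    | .inl i, .inl j => a (mixed i 0) (mixed j 1)
    | .inl i, .inr _ => a (mixed i 0) (outer k 1 2)
    | .inr _, .inl i => a (mixed i 0) (outer k 1 2)
    | .inr _, .inr _ => a (outer k 0 1) (outer k 2 3)

theorem smallBlock_eq_sub (a : Matrix (Edge (k + 4)) (Edge (k + 4)) ℝ) :
    smallBlock a = smallSame a - smallDistinct a := by
  ext r c
  obtain i | _ := r <;> obtain j | _ := c <;> rfl

/-- Entries of the family at edges `{i, p}` and `{p, r}`, for two choices of `p` and a common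
further element `r`. -/
def smallDiagonal (a : Matrix (Edge (k + 4)) (Edge (k + 4)) ℝ) :
    Matrix (Bool × (Fin k ⊕ Unit)) (Bool × (Fin k ⊕ Unit)) ℝ :=
  Matrix.of fun x y => match x.2, y.2 with
    | .inr _, .inr _ =>
      if x.1 = y.1 then a (outer k 0 1) (outer k 0 1) else a (outer k 0 1) (outer k 0 2)
    | r, c => if x.1 = y.1 then smallSame a r c else smallDistinct a r c

theorem smallBlock_posSemidef (hA : FreshInvariant k A) (h : ∀ m, (A (k + m)).PosSemidef) :
    (smallBlock (A (k + 4))).PosSemidef := by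
  rw [smallBlock_eq_sub]
  apply Matrix.PosSemidef.sub_of_bool_block
  refine Matrix.posSemidef_of_forall_block (E := smallDiagonal (A (k + 4))) ?_ fun N => ?_
  · ext ⟨b, r⟩ ⟨b', c⟩
    obtain i | _ := r <;> obtain j | _ := c <;>
      simp only [Matrix.conjTranspose_apply, smallSame, smallDistinct, Matrix.of_apply,
        star_trivial, eq_comm (a := b')]
    congr 1
    · exact hA.symm 4 _ _
    · rw [hA.symm]
      exact hA.mixed_mixed_of_ne (m := 4) i j (s := 1) (t := 0) (by decide)
  -- Two fixed fresh elements `p b` and `N` further ones `q s`. For `s ≠ t`, the edges `{p b, q s}`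
  -- and `{p b', q t}` meet exactly when `b = b'`, so the off-diagonal block has the form required
  -- by `sub_of_bool_block`.
  · let p (b : Bool) : Fin (2 + N) := Fin.castAdd N (if b then 0 else 1)
    let q (s : Fin N) : Fin (2 + N) := Fin.natAdd 2 s
    have hp (b b') : p b = p b' ↔ b = b' := by cases b <;> cases b' <;> simp [p]
    have hq (s t) : q s = q t ↔ s = t := by simp [q]
    have hpq (b s) : p b ≠ q s := castAdd_ne_natAdd _ _
    have hqp (b s) : q s ≠ p b := (hpq b s).symm
    let g : Fin N × (Bool × (Fin k ⊕ Unit)) → Edge (k + (2 + N)) := fun x => match x with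
      | (_, b, .inl i) => mixedAt i (p b)
      | (s, b, .inr _) => outerAt k (p b) (q s) (hpq b s)
    convert (h (2 + N)).submatrix g using 1
    ext ⟨s, b, r⟩ ⟨t, b', c⟩
    obtain i | _ := r <;> obtain j | _ := c <;>
      simp only [Matrix.submatrix_apply, smallSame, smallDistinct, smallDiagonal, Matrix.of_apply,
        g, ite_self]
    · rw [hA.mixed_mixed]
      simp only [hp]
      split_ifs <;> ring
    · rw [hA.mixed_outer]
      simp only [hp, hpq, if_false]
      split_ifs <;> ring
    · rw [hA.symm (2 + N), hA.mixed_outer]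
      simp only [hp, hpq, if_false, eq_comm (a := b')]
      split_ifs <;> ring
    · rw [hA.outer_outer]
      simp only [hp, hq, hpq, hqp, Sym2.eq_iff, scalarBlock, if_false, false_and, or_false]
      split_ifs <;> simp_all
      ring

/-- Alternating signs on a 4-cycle have total zero and cancel at every vertex, so only the scalar
term of the decomposition survives, with factor 4. -/
theorem scalarBlock_nonneg (hA : FreshInvariant k A) (h : (A (k + 4)).PosSemidef) :
    0 ≤ scalarBlock (A (k + 4)) := by
  let g : Fin 4 → Edge (k + 4) := ![outerAt k 0 1 (by decide), outerAt k 1 2 (by decide),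
    outerAt k 2 3 (by decide), outerAt k 3 0 (by decide)]
  have h1 := (h.submatrix g).dotProduct_mulVec_nonneg ![1, -1, 1, -1]
  simp only [dotProduct, Matrix.mulVec, Fin.sum_univ_four, Matrix.submatrix_apply, g,
    Pi.star_apply, star_trivial, Matrix.cons_val, hA.outer_outer] at h1
  simp at h1
  linarith

end FreshInvariant
end EdgeMatrix

theorem theorem1p3 (k : ℕ)
    -- only the members `A n` with `k ≤ n` of the family matter
    (A : (n : ℕ) → Matrix (EdgeMatrix.Edge n) (EdgeMatrix.Edge n) ℝ)
    (hsymm : ∀ n, k ≤ n → (A n).IsSymm)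
    (hrestrict : ∀ (m n : ℕ) (hmn : m ≤ n), k ≤ m → ∀ e f : EdgeMatrix.Edge m,
      A m e f = A n (e.incl hmn) (f.incl hmn))
    (hinv : ∀ n, k ≤ n → ∀ σ ∈ EdgeMatrix.permFixing k n, ∀ e f : EdgeMatrix.Edge n,
      A n (σ • e) (σ • f) = A n e f) :
    (∀ n, k ≤ n → (A n).PosSemidef) ↔
      0 ≤ EdgeMatrix.scalarBlock (A (k + 4)) ∧
      (EdgeMatrix.largeBlock (A (k + 4))).PosSemidef ∧
      (EdgeMatrix.smallBlock (A (k + 4))).PosSemidef := by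
  have hA := EdgeMatrix.freshInvariant_of_restrict_of_perm hsymm hrestrict hinv
  constructor
  · intro h
    have h' (m : ℕ) : (A (k + m)).PosSemidef := h _ (Nat.le_add_right k m)
    exact ⟨hA.scalarBlock_nonneg (h' 4), hA.largeBlock_posSemidef h', hA.smallBlock_posSemidef h'⟩
  · rintro ⟨hscalar, hlarge, hsmall⟩ n hn
    obtain ⟨m, rfl⟩ := Nat.exists_eq_add_of_le hn
    exact hA.posSemidef hscalar hlarge hsmall m
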